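/- For a partition $\lambda$ write $\lambda_1\ge\lambda_2\ge\cdots$ for its parts, $|\lambda|$ for its size, $\lambda'_j$ for the length of the $j$-th column of its diagram, and $h(s)=a(s)+l(s)+1$ for the hook length of a cell $s\in\lambda$, where $a(s)$ and $l(s)$ are the numbers of cells strictly to the right of $s$ in its row and strictly below $s$ in its column. For real $q\ge 2$ let $\tilde Q_q$ be the measure on the set of all partitions of all non-negative integers with $$\tilde Q_q(\lambda)=\prod_{i=1}^{\infty}\prod_{j=0}^{\infty}\Big(1-\frac1{q^{i+j}}\Big)\;\frac{1}{\prod_{j}q^{(\lambda'_j)^2}\,\prod_{s\in\lambda}\big(1-\frac1{q^{h(s)}}\big)^2},$$ and let $Q_{n,q}$ be the probability measure on partitions of size $n$ obtained by renormalizing it: $Q_{n,q}(\lambda)=\tilde Q_q(\lambda)/\sum_{|\mu|=n}\tilde Q_q(\mu)$ for $|\lambda|=n$. Let $Q_{n,q}^r$ be the $Q_{n,q}$-probability that $\lambda_1<r$. **Theorem.** Let $q\ge 2$ be real and let $n,r$ be non-negative integers with $r\le n-1$. Then 1. $$Q_{n,q}^r\le \frac{1}{(1-1/q)^{1+4\sqrt{2n}}}\left[\frac1{q^{2n-2r+2}}+\frac{1}{1-1/q^{2n+1}}\,\frac1{q^{n+1}}\right],$$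 2. $$Q_{n,q}^r\ge \Big(1-\frac1{q^n}\Big)\Big(1-\frac1q\Big)^4\left[\frac1{q^{2n-2r+2}}-\frac1{q^{n+1}(1-1/q)}-\frac1{q^{2n-2r+3}(1-1/q)^2}-\frac1{q^{3n-3r+4}(1-1/q)^3}-\frac1{(1-1/q)^2}\,\frac1{q^{2n+3}(1-1/q^{2n+3})}\right].$$ -/

import Mathlib

open scoped BigOperators

namespace YoungDiagram

/-- The arm length `a(s)` of a cell `s = (i, j)` (row `i`, column `j`, both counted from `0`):
the number of cells in the same row strictly to the right of `s`. -/
def armLength (lam : YoungDiagram) (s : ℕ × ℕ) : ℕ :=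
  (lam.cells.filter fun t => t.1 = s.1 ∧ s.2 < t.2).card

/-- The leg length `l(s)` of a cell `s`: the number of cells in the same column strictly
below `s`. -/
def legLength (lam : YoungDiagram) (s : ℕ × ℕ) : ℕ :=
  (lam.cells.filter fun t => t.2 = s.2 ∧ s.1 < t.1).card

/-- The hook length `h(s) = a(s) + l(s) + 1` of a cell `s`. -/
def hookLength (lam : YoungDiagram) (s : ℕ × ℕ) : ℕ :=
  lam.armLength s + lam.legLength s + 1

theorem finite_setOf_card_eq (n : ℕ) : {lam : YoungDiagram | lam.card = n}.Finite := by
  have hfin : ((Finset.range n ×ˢ Finset.range n).powerset : Set (Finset (ℕ × ℕ))).Finite :=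
    Finset.finite_toSet _
  refine (hfin.preimage (f := YoungDiagram.cells) ?_).subset ?_
  · intro a _ b _ h
    exact YoungDiagram.ext h
  · intro lam hlam
    have hcard : lam.card = n := hlam
    simp only [Set.mem_preimage, Finset.coe_powerset, Set.mem_powerset_iff, Finset.coe_subset]
    intro s hs
    obtain ⟨i, j⟩ := s
    have hs' : (i, j) ∈ lam := hs
    have hrow : lam.rowLen i ≤ n := by
      rw [← hcard, YoungDiagram.rowLen_eq_card]
      exact Finset.card_le_card (Finset.filter_subset _ _)
    have hcol : lam.colLen j ≤ n := by
      rw [← hcard, YoungDiagram.colLen_eq_card]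
      exact Finset.card_le_card (Finset.filter_subset _ _)
    have h1 := YoungDiagram.mem_iff_lt_rowLen.1 hs'
    have h2 := YoungDiagram.mem_iff_lt_colLen.1 hs'
    simp only [Finset.mem_product, Finset.mem_range]
    omega

/-- The finite set of all partitions of size `n`. -/
noncomputable def ofSize (n : ℕ) : Finset YoungDiagram :=
  (finite_setOf_card_eq n).toFinset

theorem mem_ofSize {n : ℕ} {lam : YoungDiagram} : lam ∈ ofSize n ↔ lam.card = n := by
  simp [ofSize]

end YoungDiagram

/-- The mass that the measure `Q̃_q` on the set of all partitions of all natural numbers gives to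
the partition `lam`:
`∏_{i ≥ 1} ∏_{j ≥ 0} (1 - 1/q^{i+j}) * 1 / (∏_j q^{(lam'_j)^2} ∏_{s ∈ lam} (1 - 1/q^{h(s)})^2)`,
where `lam'_j` is the length of the `j`-th column. -/
noncomputable def tildeQ (q : ℝ) (lam : YoungDiagram) : ℝ :=
  (∏' i : ℕ, ∏' j : ℕ, (1 - 1 / q ^ ((i + 1) + j))) *
    (1 / ((∏ j ∈ Finset.range (lam.rowLen 0), q ^ (lam.colLen j ^ 2)) *
      ∏ s ∈ lam.cells, (1 - 1 / q ^ lam.hookLength s) ^ 2))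

/-- The mass that `Q_{n,q}` gives to the partition `lam`: the measure `Q̃_q` renormalized to live
on the partitions of size `n`. -/
noncomputable def measQ (n : ℕ) (q : ℝ) (lam : YoungDiagram) : ℝ :=
  if lam.card = n then tildeQ q lam / ∑ mu ∈ YoungDiagram.ofSize n, tildeQ q mu else 0

/-- `Q_{n,q}^r`: the `Q_{n,q}`-probability that the first row has length strictly less
than `r`. -/
noncomputable def firstRowProbQ (n r : ℕ) (q : ℝ) : ℝ :=
  ∑ lam ∈ YoungDiagram.ofSize n with lam.rowLen 0 < r, measQ n q lam

/-! ### Diagrams with the first row removed or added -/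

namespace YoungDiagram

/-! Put `t = 1/q ≤ 1/2`. The infinite product cancels on normalizing, leaving the weight `w`
(`hookWeight`) and its total `Z_n` (`hookSum`) over size `n`. Removing the first row of `λ` gives
`μ` with `w(λ) = t^(|λ|+|μ|) w(μ) / H²`, where `H` is the product of the factors `1 - t^h` over the
first row. These hooks are distinct and lie in `[1, n]`, so `H ≥ (t;t)_n`, with equality for the
one-row partition, whose weight is `t^n/(t;t)_n²`.

Hence the probability of `λ_1 < r` is at most the sum of `t^m Z_m` over the tail sizes `n+1-r ≤ m <
n`. Feeding the same recursion into itself gives `Z_m ≤ t^m / ((1-t)^6 (1-t²)^4)`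
(`hookSum_le_of_le_half`), and a geometric series then gives `t^(2(n+1-r))/(1-t)^9`, which suffices
since `1 + 4√(2n) ≥ 9` once `n ≥ 2`.

For the lower bound let `k = n+1-r`. If `k < r`, the single partition `(r-1, k)` already has
probability at least `(1-t)^4 t^(2k)`. If `k ≥ r`, then `2k ≥ n+1` and the bracket is nonpositive.
The other correction terms matter only through their signs. -/

theorem armLength_eq (lam : YoungDiagram) (i j : ℕ) :
    lam.armLength (i, j) = lam.rowLen i - (j + 1) := by
  have h : (lam.cells.filter fun t => t.1 = (i, j).1 ∧ (i, j).2 < t.2) =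
      {i} ×ˢ Finset.Ico (j + 1) (lam.rowLen i) := by
    ext ⟨a, b⟩
    simp only [Finset.mem_filter, Finset.mem_product, Finset.mem_singleton, Finset.mem_Ico,
      mem_cells, mem_iff_lt_rowLen]
    constructor
    · rintro ⟨h1, rfl, h2⟩
      exact ⟨rfl, h2, h1⟩
    · rintro ⟨rfl, h2, h1⟩
      exact ⟨h1, rfl, h2⟩
  rw [armLength, h, Finset.card_product]
  simp

theorem legLength_eq (lam : YoungDiagram) (i j : ℕ) :
    lam.legLength (i, j) = lam.colLen j - (i + 1) := by
  have h : (lam.cells.filter fun t => t.2 = (i, j).2 ∧ (i, j).1 < t.1) =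
      Finset.Ico (i + 1) (lam.colLen j) ×ˢ {j} := by
    ext ⟨a, b⟩
    simp only [Finset.mem_filter, Finset.mem_product, Finset.mem_singleton, Finset.mem_Ico,
      mem_cells, mem_iff_lt_colLen]
    constructor
    · rintro ⟨h1, rfl, h2⟩
      exact ⟨⟨h2, h1⟩, rfl⟩
    · rintro ⟨⟨h2, h1⟩, rfl⟩
      exact ⟨h1, rfl, h2⟩
  rw [legLength, h, Finset.card_product]
  simp

theorem hookLength_eq (lam : YoungDiagram) (i j : ℕ) :
    lam.hookLength (i, j) = (lam.rowLen i - (j + 1)) + (lam.colLen j - (i + 1)) + 1 := by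
  rw [hookLength, armLength_eq, legLength_eq]

theorem colLen_le_card (lam : YoungDiagram) (j : ℕ) : lam.colLen j ≤ lam.card := by
  rw [colLen_eq_card]
  exact Finset.card_le_card (Finset.filter_subset _ _)

theorem colLen_eq_zero_of_rowLen_le (lam : YoungDiagram) {j : ℕ} (h : lam.rowLen 0 ≤ j) :
    lam.colLen j = 0 := by
  by_contra h0
  have h1 : (0, j) ∈ lam := mem_iff_lt_colLen.2 (Nat.pos_of_ne_zero h0)
  exact absurd (mem_iff_lt_rowLen.1 h1) (not_lt.2 h)

theorem sum_colLen (lam : YoungDiagram) {N : ℕ} (h : lam.rowLen 0 ≤ N) :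
    ∑ j ∈ Finset.range N, lam.colLen j = lam.card := by
  symm
  rw [YoungDiagram.card, Finset.card_eq_sum_card_fiberwise (f := Prod.snd) (t := Finset.range N)]
  · refine Finset.sum_congr rfl fun j _ => ?_
    rw [colLen_eq_card]
    rfl
  · rintro ⟨i, j⟩ hs
    have h1 : (0, j) ∈ lam := lam.up_left_mem (Nat.zero_le i) le_rfl hs
    have h2 := mem_iff_lt_rowLen.1 h1
    simp only [Finset.coe_range, Set.mem_Iio]
    omega

theorem succ_fst_injective : Function.Injective fun s : ℕ × ℕ => (s.1 + 1, s.2) := by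
  rintro ⟨a, b⟩ ⟨c, d⟩ h
  simpa using h

/-- The diagram obtained by removing the first row. -/
noncomputable def tail (lam : YoungDiagram) : YoungDiagram where
  cells := lam.cells.preimage (fun s => (s.1 + 1, s.2)) (succ_fst_injective.injOn)
  isLowerSet := by
    rintro ⟨a, b⟩ ⟨c, d⟩ h hs
    simp only [Finset.coe_preimage, Set.mem_preimage, Finset.mem_coe, mem_cells] at hs ⊢
    exact lam.up_left_mem (Nat.succ_le_succ h.1) h.2 hs

theorem mem_tail {lam : YoungDiagram} {i j : ℕ} : (i, j) ∈ lam.tail ↔ (i + 1, j) ∈ lam := by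
  rw [← mem_cells, ← mem_cells, tail, Finset.mem_preimage]

theorem rowLen_tail (lam : YoungDiagram) (i : ℕ) : lam.tail.rowLen i = lam.rowLen (i + 1) := by
  refine eq_of_forall_lt_iff fun j => ?_
  rw [← mem_iff_lt_rowLen, ← mem_iff_lt_rowLen, mem_tail]

theorem colLen_tail (lam : YoungDiagram) (j : ℕ) : lam.tail.colLen j = lam.colLen j - 1 := by
  refine eq_of_forall_lt_iff fun i => ?_
  rw [← mem_iff_lt_colLen, mem_tail, mem_iff_lt_colLen]
  omega

theorem colLen_eq_colLen_tail_add_one (lam : YoungDiagram) {j : ℕ} (hj : j < lam.rowLen 0) :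
    lam.colLen j = lam.tail.colLen j + 1 := by
  have h : 0 < lam.colLen j := mem_iff_lt_colLen.1 (mem_iff_lt_rowLen.2 hj)
  rw [colLen_tail]
  omega

theorem rowLen_tail_zero_le (lam : YoungDiagram) : lam.tail.rowLen 0 ≤ lam.rowLen 0 := by
  rw [rowLen_tail]
  exact lam.rowLen_anti _ _ (Nat.zero_le _)

theorem hookLength_tail (lam : YoungDiagram) (s : ℕ × ℕ) :
    lam.tail.hookLength s = lam.hookLength (s.1 + 1, s.2) := by
  obtain ⟨i, j⟩ := s
  rw [hookLength_eq, hookLength_eq, rowLen_tail, colLen_tail]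
  dsimp only
  omega

theorem card_eq_rowLen_add_card_tail (lam : YoungDiagram) :
    lam.card = lam.rowLen 0 + lam.tail.card := by
  rw [← lam.sum_colLen le_rfl, ← lam.tail.sum_colLen lam.rowLen_tail_zero_le,
    Finset.sum_congr rfl fun j hj => lam.colLen_eq_colLen_tail_add_one (Finset.mem_range.1 hj),
    Finset.sum_add_distrib]
  simp [add_comm]

theorem prod_cells {M : Type*} [CommMonoid M] (lam : YoungDiagram) (f : ℕ × ℕ → M) :
    ∏ s ∈ lam.cells, f s =
      (∏ j ∈ Finset.range (lam.rowLen 0), f (0, j)) *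
        ∏ s ∈ lam.tail.cells, f (s.1 + 1, s.2) := by
  rw [← Finset.prod_filter_mul_prod_filter_not lam.cells (fun s => s.1 = 0)]
  congr 1
  · symm
    refine Finset.prod_bij (fun j _ => (0, j)) ?_ ?_ ?_ fun _ _ => rfl
    · intro j hj
      simpa [mem_iff_lt_rowLen] using hj
    · intro a _ b _ h
      simpa using h
    · rintro ⟨i, j⟩ h
      simp only [Finset.mem_filter, mem_cells] at h
      obtain ⟨h, rfl⟩ := h
      exact ⟨j, by simpa [mem_iff_lt_rowLen] using h, rfl⟩
  · symm
    refine Finset.prod_bij (fun s _ => (s.1 + 1, s.2)) ?_ ?_ ?_ fun _ _ => rfl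
    · rintro ⟨i, j⟩ h
      simpa [mem_tail] using h
    · rintro ⟨a, b⟩ _ ⟨c, d⟩ _ h
      simpa using h
    · rintro ⟨i, j⟩ h
      simp only [Finset.mem_filter, mem_cells] at h
      obtain ⟨h, h0⟩ := h
      obtain ⟨i, rfl⟩ := Nat.exists_eq_succ_of_ne_zero h0
      exact ⟨(i, j), by simpa [mem_tail] using h, rfl⟩

theorem eq_of_rowLen_eq_of_tail_eq {lam mu : YoungDiagram} (h0 : lam.rowLen 0 = mu.rowLen 0)
    (h : lam.tail = mu.tail) : lam = mu := by
  refine YoungDiagram.ext ?_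
  ext ⟨i, j⟩
  rw [mem_cells, mem_cells]
  rcases i with _ | i
  · rw [mem_iff_lt_rowLen, mem_iff_lt_rowLen, h0]
  · rw [← mem_tail, ← mem_tail, h]

/-- The diagram obtained by putting a row of length `l` on top of `mu`. -/
def consRow (l : ℕ) (mu : YoungDiagram) : YoungDiagram where
  -- No column of `mu` exceeds `mu.card`, so the box cuts nothing off vertically; rows longer than
  -- `l` are truncated.
  cells := (Finset.range (mu.card + 1) ×ˢ Finset.range l).filter
    fun s => s.1 = 0 ∨ (s.1 - 1, s.2) ∈ mu
  isLowerSet := by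
    rintro ⟨a, b⟩ ⟨c, d⟩ hle hs
    simp only [Finset.coe_filter, Finset.mem_product, Finset.mem_range, Set.mem_ofPred_eq] at hs ⊢
    have h1 : c ≤ a := hle.1
    have h2 : d ≤ b := hle.2
    refine ⟨⟨by omega, by omega⟩, ?_⟩
    rcases hs.2 with h0 | h0
    · left
      omega
    · exact Or.inr (mu.up_left_mem (by omega) h2 h0)

theorem rowLen_consRow (l : ℕ) (mu : YoungDiagram) :
    (consRow l mu).rowLen 0 = l := by
  refine eq_of_forall_lt_iff fun j => ?_
  rw [← mem_iff_lt_rowLen, ← mem_cells, consRow]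
  simp

theorem tail_consRow (l : ℕ) (mu : YoungDiagram) (h : mu.rowLen 0 ≤ l) :
    (consRow l mu).tail = mu := by
  refine YoungDiagram.ext ?_
  ext ⟨i, j⟩
  rw [mem_cells, mem_cells, mem_tail, ← mem_cells, consRow]
  simp only [Finset.mem_filter, Finset.mem_product, Finset.mem_range, Nat.add_sub_cancel,
    Nat.add_one_ne_zero, false_or, and_iff_right_iff_imp]
  intro hs
  have h1 := mem_iff_lt_colLen.1 hs
  have h2 := mem_iff_lt_rowLen.1 (mu.up_left_mem (Nat.zero_le i) le_rfl hs)
  have h3 := mu.colLen_le_card j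
  omega

theorem card_consRow (l : ℕ) (mu : YoungDiagram) (h : mu.rowLen 0 ≤ l) :
    (consRow l mu).card = l + mu.card := by
  rw [card_eq_rowLen_add_card_tail, rowLen_consRow, tail_consRow l mu h]

end YoungDiagram

/-! ### Finite products of `1 - t^i` -/

/-- The finite `q`-Pochhammer symbol `∏_{i = 1}^{n} (1 - t ^ i)`. -/
noncomputable def qFactor (t : ℝ) (n : ℕ) : ℝ := ∏ i ∈ Finset.range n, (1 - t ^ (i + 1))

theorem qFactor_zero (t : ℝ) : qFactor t 0 = 1 := by simp [qFactor]

theorem qFactor_succ (t : ℝ) (n : ℕ) :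
    qFactor t (n + 1) = qFactor t n * (1 - t ^ (n + 1)) := by
  simp [qFactor, Finset.prod_range_succ]

theorem one_sub_pow_pos {t : ℝ} (h0 : 0 < t) (h1 : t < 1) {m : ℕ} (hm : m ≠ 0) :
    0 < 1 - t ^ m :=
  sub_pos.2 (pow_lt_one₀ h0.le h1 hm)

theorem one_sub_pow_le_one {t : ℝ} (h0 : 0 < t) (m : ℕ) : 1 - t ^ m ≤ 1 :=
  sub_le_self _ (pow_pos h0 m).le

theorem qFactor_pos {t : ℝ} (h0 : 0 < t) (h1 : t < 1) (n : ℕ) : 0 < qFactor t n :=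
  Finset.prod_pos fun _ _ => one_sub_pow_pos h0 h1 (Nat.succ_ne_zero _)

/-- Distinct exponents in `[1, n]` select a subproduct of `(t;t)_n`; the omitted factors are at most
1. -/
theorem qFactor_le_prod {t : ℝ} (h0 : 0 < t) (h1 : t < 1) {n l : ℕ} (h : ℕ → ℕ)
    (hinj : Set.InjOn h (Finset.range l)) (hpos : ∀ j < l, 0 < h j) (hle : ∀ j < l, h j ≤ n) :
    qFactor t n ≤ ∏ j ∈ Finset.range l, (1 - t ^ h j) := by
  have h2 : qFactor t n = ∏ i ∈ Finset.Icc 1 n, (1 - t ^ i) := by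
    rw [qFactor, Finset.range_eq_Ico, Finset.prod_Ico_add' (fun i => 1 - t ^ i) 0 n 1]
    rfl
  have hsub : (Finset.range l).image h ⊆ Finset.Icc 1 n := by
    intro i hi
    obtain ⟨j, hj, rfl⟩ := Finset.mem_image.1 hi
    have hj' := Finset.mem_range.1 hj
    exact Finset.mem_Icc.2 ⟨hpos j hj', hle j hj'⟩
  have hpos' : ∀ i ∈ Finset.Icc 1 n, 0 < 1 - t ^ i := fun i hi =>
    one_sub_pow_pos h0 h1 (by have := (Finset.mem_Icc.1 hi).1; omega)
  rw [h2, ← Finset.prod_image (f := fun i => 1 - t ^ i) hinj, ← Finset.prod_sdiff hsub]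
  refine mul_le_of_le_one_left (Finset.prod_nonneg fun i hi => (hpos' i (hsub hi)).le) ?_
  exact Finset.prod_le_one (fun i hi => (hpos' i (Finset.mem_sdiff.1 hi).1).le)
    fun i _ => one_sub_pow_le_one h0 i

/-! ### Weights and the first-row recursion -/

namespace YoungDiagram

/-- The unnormalized mass of a partition: `∏_j t^{(lam'_j)^2} / ∏_{s ∈ lam} (1 - t^{h(s)})^2`. -/
noncomputable def hookWeight (t : ℝ) (lam : YoungDiagram) : ℝ :=
  (∏ j ∈ Finset.range (lam.rowLen 0), t ^ (lam.colLen j ^ 2)) /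
    ∏ s ∈ lam.cells, (1 - t ^ lam.hookLength s) ^ 2

theorem hookWeight_bot (t : ℝ) : hookWeight t ⊥ = 1 := by
  have h : (⊥ : YoungDiagram).rowLen 0 = 0 := by
    by_contra h0
    exact notMem_bot (0, 0) (mem_iff_lt_rowLen.2 (Nat.pos_of_ne_zero h0))
  simp [hookWeight, h]

theorem hookWeight_pos {t : ℝ} (h0 : 0 < t) (h1 : t < 1) (lam : YoungDiagram) :
    0 < hookWeight t lam :=
  div_pos (Finset.prod_pos fun _ _ => pow_pos h0 _)
    (Finset.prod_pos fun _ _ => pow_pos (one_sub_pow_pos h0 h1 (Nat.succ_ne_zero _)) 2)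

/-- Each nonempty column loses one cell, and `(c+1)² = c² + (2c+1)`; the increments add up to
`2|tail| + λ_1`. -/
theorem sum_colLen_sq (lam : YoungDiagram) :
    ∑ j ∈ Finset.range (lam.rowLen 0), lam.colLen j ^ 2 =
      (∑ j ∈ Finset.range (lam.tail.rowLen 0), lam.tail.colLen j ^ 2) +
        (lam.card + lam.tail.card) := by
  have h1 : ∑ j ∈ Finset.range (lam.tail.rowLen 0), lam.tail.colLen j ^ 2 =
      ∑ j ∈ Finset.range (lam.rowLen 0), lam.tail.colLen j ^ 2 := by
    refine Finset.sum_subset (Finset.range_subset_range.2 lam.rowLen_tail_zero_le) ?_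
    intro j _ hj
    rw [lam.tail.colLen_eq_zero_of_rowLen_le (by simpa using hj)]
    rfl
  have h2 : ∀ j ∈ Finset.range (lam.rowLen 0),
      lam.colLen j ^ 2 = lam.tail.colLen j ^ 2 + (2 * lam.tail.colLen j + 1) := by
    intro j hj
    rw [lam.colLen_eq_colLen_tail_add_one (Finset.mem_range.1 hj)]
    ring
  rw [h1, Finset.sum_congr rfl h2, Finset.sum_add_distrib, Finset.sum_add_distrib,
    ← Finset.mul_sum, lam.tail.sum_colLen lam.rowLen_tail_zero_le,
    lam.card_eq_rowLen_add_card_tail]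
  simp
  ring

theorem hookLength_zero (lam : YoungDiagram) {j : ℕ} (hj : j < lam.rowLen 0) :
    lam.hookLength (0, j) = lam.rowLen 0 - j + lam.tail.colLen j := by
  rw [hookLength_eq, colLen_tail]
  omega

theorem hookWeight_eq (t : ℝ) (lam : YoungDiagram) :
    hookWeight t lam = t ^ (lam.card + lam.tail.card) * hookWeight t lam.tail /
      (∏ j ∈ Finset.range (lam.rowLen 0), (1 - t ^ lam.hookLength (0, j))) ^ 2 := by
  rw [hookWeight, hookWeight, Finset.prod_pow_eq_pow_sum, Finset.prod_pow_eq_pow_sum,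
    sum_colLen_sq, pow_add, lam.prod_cells, Finset.prod_pow]
  simp only [hookLength_tail]
  rw [mul_comm (t ^ _) (t ^ (_ + _)), mul_div_assoc', div_div, mul_comm (∏ _ ∈ _, _ ^ 2)]

/-- Hook lengths strictly decrease along the first row and never exceed the size of the diagram. -/
theorem qFactor_le_prod_firstRow {t : ℝ} (h0 : 0 < t) (h1 : t < 1) (lam : YoungDiagram) :
    qFactor t lam.card ≤
      ∏ j ∈ Finset.range (lam.rowLen 0), (1 - t ^ lam.hookLength (0, j)) := by
  refine qFactor_le_prod h0 h1 (fun j => lam.hookLength (0, j)) ?_ (fun _ _ => Nat.succ_pos _) ?_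
  · have hanti : StrictAntiOn (fun j => lam.hookLength (0, j))
        (Finset.range (lam.rowLen 0)) := by
      intro i hi j hj hij
      simp only [Finset.coe_range, Set.mem_Iio] at hi hj
      have := lam.tail.colLen_anti i j hij.le
      simp only [lam.hookLength_zero hi, lam.hookLength_zero hj]
      omega
    exact hanti.injOn
  · intro j hj
    have := lam.tail.colLen_le_card j
    have := lam.card_eq_rowLen_add_card_tail
    simp only [lam.hookLength_zero hj]
    omega

theorem hookWeight_le {t : ℝ} (h0 : 0 < t) (h1 : t < 1) (lam : YoungDiagram) :
    hookWeight t lam ≤ t ^ lam.card / qFactor t lam.card ^ 2 *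
      (t ^ lam.tail.card * hookWeight t lam.tail) := by
  rw [hookWeight_eq, pow_add, div_mul_eq_mul_div, mul_assoc]
  have hq := qFactor_pos h0 h1 lam.card
  have hw := hookWeight_pos h0 h1 lam.tail
  gcongr
  exact qFactor_le_prod_firstRow h0 h1 lam

/-! ### Total weights and their recursive bounds -/

/-- The total unnormalized mass of the partitions of size `n`. -/
noncomputable def hookSum (t : ℝ) (n : ℕ) : ℝ := ∑ lam ∈ ofSize n, hookWeight t lam

theorem hookSum_nonneg {t : ℝ} (h0 : 0 < t) (h1 : t < 1) (n : ℕ) : 0 ≤ hookSum t n :=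
  Finset.sum_nonneg fun lam _ => (hookWeight_pos h0 h1 lam).le

theorem hookWeight_le_hookSum {t : ℝ} (h0 : 0 < t) (h1 : t < 1) (lam : YoungDiagram) :
    hookWeight t lam ≤ hookSum t lam.card :=
  Finset.single_le_sum (f := hookWeight t) (fun mu _ => (hookWeight_pos h0 h1 mu).le)
    (mem_ofSize.2 rfl)

theorem hookSum_zero (t : ℝ) : hookSum t 0 = 1 := by
  have h : ofSize 0 = {⊥} := by
    ext lam
    rw [mem_ofSize, Finset.mem_singleton, YoungDiagram.card, Finset.card_eq_zero]
    exact ⟨fun h => YoungDiagram.ext (by rw [h, cells_bot]), fun h => by rw [h, cells_bot]⟩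
  rw [hookSum, h, Finset.sum_singleton, hookWeight_bot]

/-- At fixed size the tail determines the diagram, so the sum over `λ` is bounded by a sum over all
possible tails, grouped by size. A first row of length between 1 and `r - 1` leaves a tail of size
in `[n+1-r, n)`. -/
theorem sum_hookWeight_filter_le {t : ℝ} (h0 : 0 < t) (h1 : t < 1) {n r : ℕ} (hn : 0 < n) :
    ∑ lam ∈ ofSize n with lam.rowLen 0 < r, hookWeight t lam ≤
      t ^ n / qFactor t n ^ 2 * ∑ m ∈ Finset.Ico (n + 1 - r) n, t ^ m * hookSum t m := by
  classical
  have hq := qFactor_pos h0 h1 n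
  set S := (ofSize n).filter fun lam => lam.rowLen 0 < r with hS
  have hmem : ∀ lam ∈ S, lam.card = n ∧ lam.rowLen 0 < r := by
    intro lam h
    rw [hS, Finset.mem_filter, mem_ofSize] at h
    exact h
  have h2 : ∑ lam ∈ S, hookWeight t lam ≤ t ^ n / qFactor t n ^ 2 *
      ∑ lam ∈ S, t ^ lam.tail.card * hookWeight t lam.tail := by
    rw [Finset.mul_sum]
    refine Finset.sum_le_sum fun lam h => ?_
    have := hookWeight_le h0 h1 lam
    rwa [(hmem lam h).1] at this
  refine h2.trans (mul_le_mul_of_nonneg_left ?_ (by positivity))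
  have hinj : Set.InjOn tail (S : Set YoungDiagram) := by
    intro lam hl mu hm h
    have e1 := lam.card_eq_rowLen_add_card_tail
    have e2 := mu.card_eq_rowLen_add_card_tail
    rw [(hmem lam hl).1] at e1
    rw [(hmem mu hm).1, ← h] at e2
    exact eq_of_rowLen_eq_of_tail_eq (by omega) h
  have hdisj : Set.PairwiseDisjoint (Finset.Ico (n + 1 - r) n : Set ℕ) ofSize := by
    intro a _ b _ hab
    refine Finset.disjoint_left.2 fun lam ha hb => hab ?_
    rw [← mem_ofSize.1 ha, mem_ofSize.1 hb]
  have hsum : ∑ m ∈ Finset.Ico (n + 1 - r) n, t ^ m * hookSum t m =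
      ∑ mu ∈ (Finset.Ico (n + 1 - r) n).disjiUnion ofSize hdisj,
        t ^ mu.card * hookWeight t mu := by
    rw [Finset.sum_disjiUnion]
    refine Finset.sum_congr rfl fun m _ => ?_
    rw [hookSum, Finset.mul_sum]
    exact Finset.sum_congr rfl fun mu hmu => by rw [mem_ofSize.1 hmu]
  rw [hsum, ← Finset.sum_image (f := fun mu => t ^ mu.card * hookWeight t mu) hinj]
  refine Finset.sum_le_sum_of_subset_of_nonneg ?_ fun mu _ _ =>
    (mul_pos (pow_pos h0 _) (hookWeight_pos h0 h1 mu)).le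
  intro mu hmu
  obtain ⟨lam, hl, rfl⟩ := Finset.mem_image.1 hmu
  obtain ⟨hc, hr⟩ := hmem lam hl
  have e := lam.card_eq_rowLen_add_card_tail
  have hpos : 0 < lam.rowLen 0 := by
    have hne : lam.cells.Nonempty := by
      rw [← Finset.card_pos]
      exact hn.trans_eq hc.symm
    obtain ⟨⟨i, j⟩, hs⟩ := hne
    exact (Nat.zero_le j).trans_lt
      (mem_iff_lt_rowLen.1 (lam.up_left_mem (Nat.zero_le i) le_rfl hs))
  rw [Finset.mem_disjiUnion]
  exact ⟨lam.tail.card, Finset.mem_Ico.2 ⟨by omega, by omega⟩, mem_ofSize.2 rfl⟩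

theorem rowLen_le_card (lam : YoungDiagram) (i : ℕ) : lam.rowLen i ≤ lam.card := by
  rw [rowLen_eq_card]
  exact Finset.card_le_card (Finset.filter_subset _ _)

theorem hookSum_le {t : ℝ} (h0 : 0 < t) (h1 : t < 1) {n : ℕ} (hn : 0 < n) :
    hookSum t n ≤
      t ^ n / qFactor t n ^ 2 * ∑ m ∈ Finset.range n, t ^ m * hookSum t m := by
  have h := sum_hookWeight_filter_le h0 h1 (r := n + 1) hn
  rw [Finset.filter_true_of_mem, Nat.sub_self, ← Finset.range_eq_Ico] at h
  · exact h
  · intro lam hl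
    have := lam.rowLen_le_card 0
    rw [mem_ofSize.1 hl] at this
    omega

/-! ### One-row and two-row partitions -/

/-- The mass of the one-row partition. -/
theorem hookWeight_consRow_bot (t : ℝ) (n : ℕ) :
    hookWeight t (consRow n ⊥) = t ^ n / qFactor t n ^ 2 := by
  have hb : (⊥ : YoungDiagram).rowLen 0 ≤ n := (rowLen_le_card _ _).trans (Nat.zero_le n)
  have hc : (⊥ : YoungDiagram).card = 0 := rfl
  rw [hookWeight_eq, tail_consRow _ _ hb, hookWeight_bot, rowLen_consRow, card_consRow _ _ hb,
    hc, mul_one, qFactor, ← Finset.prod_range_reflect]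
  congr 2
  refine Finset.prod_congr rfl fun j hj => ?_
  have hj' := Finset.mem_range.1 hj
  rw [hookLength_zero _ (by rw [rowLen_consRow]; omega), rowLen_consRow, tail_consRow _ _ hb]
  have h3 := (⊥ : YoungDiagram).colLen_le_card (n - 1 - j)
  rw [hc] at h3
  congr 2
  omega

theorem le_hookSum {t : ℝ} (h0 : 0 < t) (h1 : t < 1) (n : ℕ) :
    t ^ n / qFactor t n ^ 2 ≤ hookSum t n := by
  have hb : (⊥ : YoungDiagram).rowLen 0 ≤ n := (rowLen_le_card _ _).trans (Nat.zero_le n)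
  have hc : (⊥ : YoungDiagram).card = 0 := rfl
  have h := hookWeight_le_hookSum h0 h1 (consRow n ⊥)
  rwa [hookWeight_consRow_bot, card_consRow _ _ hb, hc, add_zero] at h

theorem qFactor_le_of_two_le {t : ℝ} (h0 : 0 < t) (h1 : t < 1) {k : ℕ} (hk : 2 ≤ k) :
    qFactor t k ≤ (1 - t) * (1 - t ^ 2) := by
  induction k, hk using Nat.le_induction with
  | base => simp [qFactor, Finset.prod_range_succ]
  | succ k _ ih =>
    rw [qFactor_succ]
    exact (mul_le_of_le_one_right (qFactor_pos h0 h1 k).le (one_sub_pow_le_one h0 _)).trans ih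

/-- A lower bound for the mass of the two-row partition `(a, k)`. -/
theorem le_hookWeight_two_rows {t : ℝ} (h0 : 0 < t) (h1 : t < 1) {a k : ℕ} (hk : 2 ≤ k)
    (hka : k ≤ a) :
    t ^ (a + k) * t ^ (2 * k) / ((1 - t) ^ 2 * (1 - t ^ 2) ^ 4) ≤
      hookWeight t (consRow a (consRow k ⊥)) := by
  have hb : (⊥ : YoungDiagram).rowLen 0 ≤ k := (rowLen_le_card _ _).trans (Nat.zero_le k)
  have hc : (⊥ : YoungDiagram).card = 0 := rfl
  have hck : (consRow k ⊥).card = k := by rw [card_consRow _ _ hb, hc, add_zero]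
  have hr : (consRow k ⊥).rowLen 0 ≤ a := by rwa [rowLen_consRow]
  have hu : 0 < 1 - t := sub_pos.2 h1
  have hu2 : 0 < 1 - t ^ 2 := one_sub_pow_pos h0 h1 two_ne_zero
  have hqk := qFactor_pos h0 h1 k
  have hfac : ∀ j, 0 < 1 - t ^ (consRow a (consRow k ⊥)).hookLength (0, j) := fun j =>
    one_sub_pow_pos h0 h1 (Nat.succ_ne_zero _)
  have hprod : ∏ j ∈ Finset.range a, (1 - t ^ (consRow a (consRow k ⊥)).hookLength (0, j)) ≤
      1 - t ^ 2 := by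
    obtain ⟨b, rfl⟩ : ∃ b, a = b + 1 := ⟨a - 1, by omega⟩
    rw [Finset.prod_range_succ]
    -- Only the last cell of the first row is kept; its hook length is 1 or 2.
    refine (mul_le_of_le_one_left (hfac b).le
      (Finset.prod_le_one (fun j _ => (hfac j).le) fun j _ => one_sub_pow_le_one h0 _)).trans ?_
    refine sub_le_sub_left (pow_le_pow_of_le_one h0.le h1.le ?_) 1
    have hcol : (consRow k ⊥).colLen b ≤ 1 := by
      have e1 := (consRow k ⊥).colLen_tail b
      have e2 := (⊥ : YoungDiagram).colLen_le_card b
      rw [tail_consRow _ _ hb] at e1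
      omega
    rw [hookLength_zero _ (by rw [rowLen_consRow]; omega), rowLen_consRow, tail_consRow _ _ hr]
    omega
  have hpos : 0 < ∏ j ∈ Finset.range a, (1 - t ^ (consRow a (consRow k ⊥)).hookLength (0, j)) :=
    Finset.prod_pos fun j _ => hfac j
  rw [hookWeight_eq, tail_consRow _ _ hr, rowLen_consRow, card_consRow _ _ hr, hck,
    hookWeight_consRow_bot, mul_div_assoc', div_div]
  generalize ∏ j ∈ Finset.range a, (1 - t ^ (consRow a (consRow k ⊥)).hookLength (0, j)) = x
    at hprod hpos ⊢
  calc t ^ (a + k) * t ^ (2 * k) / ((1 - t) ^ 2 * (1 - t ^ 2) ^ 4)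
      = t ^ (a + k + k) * t ^ k / (((1 - t) * (1 - t ^ 2)) ^ 2 * (1 - t ^ 2) ^ 2) := by
        congr 1 <;> ring
    _ ≤ _ := div_le_div_of_nonneg_left (by positivity) (by positivity)
        (mul_le_mul (pow_le_pow_left₀ hqk.le (qFactor_le_of_two_le h0 h1 hk) 2)
          (pow_le_pow_left₀ hpos.le hprod 2) (by positivity) (by positivity))

/-! ### Closed bound for the total weight -/

theorem le_qFactor {t : ℝ} (h0 : 0 < t) (h1 : t < 1) (n : ℕ) : 1 - t - t ^ 2 ≤ qFactor t n := by
  rcases n with _ | n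
  · rw [qFactor_zero]
    nlinarith
  -- The extra term `t^(n+2)` makes the induction close; equality holds at `n = 0`.
  · suffices h : 1 - t - t ^ 2 + t ^ (n + 2) ≤ qFactor t (n + 1) by
      linarith [pow_pos h0 (n + 2)]
    induction n with
    | zero => simp [qFactor]
    | succ n ih =>
      rw [qFactor_succ]
      have hx : t ^ (n + 2) ≤ t ^ 2 := pow_le_pow_of_le_one h0.le h1.le (by omega)
      have hx0 : 0 < t ^ (n + 2) := pow_pos h0 _
      have hm := mul_le_mul_of_nonneg_right ih
        (one_sub_pow_pos h0 h1 (m := n + 2) (by omega)).le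
      refine le_trans ?_ hm
      rw [show t ^ (n + 1 + 2) = t ^ (n + 2) * t by ring]
      nlinarith [mul_nonneg hx0.le (sub_nonneg.2 hx)]

theorem pow_succ_le_qFactor_sq {t : ℝ} (h0 : 0 < t) (ht : t ≤ 1 / 2) {n : ℕ} (hn : 2 ≤ n) :
    t ^ (n + 1) ≤ qFactor t n ^ 2 := by
  -- The uniform bound `1/4` gives only `1/16`, too weak against `t^3 ≤ 1/8` when `n = 2`; there
  -- `(3/8)² = 9/64` suffices.
  rcases hn.eq_or_lt with rfl | hn
  · have h : (3 / 8 : ℝ) ≤ qFactor t 2 := by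
      have e : qFactor t 2 = (1 - t) * (1 - t ^ 2) := by simp [qFactor, Finset.prod_range_succ]
      have e2 : t ^ 2 ≤ (1 / 2) ^ 2 := by gcongr
      rw [e]
      calc (3 / 8 : ℝ) = 1 / 2 * (3 / 4) := by norm_num
        _ ≤ _ := by gcongr <;> linarith
    have h3 : t ^ (2 + 1) ≤ (1 / 2) ^ 3 := by gcongr
    have h4 : (3 / 8 : ℝ) ^ 2 ≤ qFactor t 2 ^ 2 := by gcongr
    exact h3.trans (le_trans (by norm_num) h4)
  · have h : (1 / 4 : ℝ) ≤ qFactor t n := (by nlinarith : (1 / 4 : ℝ) ≤ 1 - t - t ^ 2).trans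
      (le_qFactor h0 (by linarith) n)
    have h4 : t ^ (n + 1) ≤ t ^ 4 := pow_le_pow_of_le_one h0.le (by linarith) (by omega)
    have h5 : t ^ 4 ≤ (1 / 2) ^ 4 := by gcongr
    nlinarith

/-- Passing from `n` to `n + 1` multiplies the partial sum by at most `1 + y` and the Pochhammer
factor by `1 - y`, with `y = t^(n+1)`; their product is at most 1. The index lag of 2 makes
`pow_succ_le_qFactor_sq` applicable at each step. -/
theorem sum_pow_mul_hookSum_mul_le {t : ℝ} (h0 : 0 < t) (ht : t ≤ 1 / 2) (n : ℕ) :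
    (∑ m ∈ Finset.range (n + 2), t ^ m * hookSum t m) * ((1 - t) * qFactor t n) ≤ 1 := by
  have h1 : t < 1 := by linarith
  have hu : 0 < 1 - t := sub_pos.2 h1
  induction n with
  | zero =>
    have h := hookSum_le h0 h1 one_pos
    simp only [Finset.sum_range_succ, Finset.sum_range_zero, qFactor,
      Finset.prod_range_zero] at h ⊢
    norm_num [hookSum_zero] at h ⊢
    have h2 : t / (1 - t) ^ 2 * (t * (1 - t)) ≤ t := by
      rw [div_mul_eq_mul_div, div_le_iff₀ (by positivity)]
      nlinarith [mul_pos h0 hu]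
    nlinarith [mul_le_mul_of_nonneg_right h (mul_pos h0 hu).le]
  | succ n ih =>
    set P := ∑ m ∈ Finset.range (n + 2), t ^ m * hookSum t m with hP
    have hP0 : 0 ≤ P := Finset.sum_nonneg fun m _ =>
      mul_nonneg (pow_pos h0 m).le (hookSum_nonneg h0 h1 m)
    have hq := qFactor_pos h0 h1 n
    have hq2 := qFactor_pos h0 h1 (n + 2)
    have hy : 0 < t ^ (n + 1) := pow_pos h0 _
    have hy1 : 0 < 1 - t ^ (n + 1) := one_sub_pow_pos h0 h1 (Nat.succ_ne_zero n)
    have hZ : t ^ (n + 2) * hookSum t (n + 2) ≤ t ^ (n + 1) * P := by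
      have h := hookSum_le h0 h1 (Nat.succ_pos (n + 1))
      have h3 := pow_succ_le_qFactor_sq h0 ht (Nat.le_add_left 2 n)
      calc t ^ (n + 2) * hookSum t (n + 2)
          ≤ t ^ (n + 2) * (t ^ (n + 2) / qFactor t (n + 2) ^ 2 * P) := by gcongr
        _ = t ^ (n + 1) * (t ^ (n + 2 + 1) / qFactor t (n + 2) ^ 2) * P := by ring
        _ ≤ t ^ (n + 1) * 1 * P := by
            gcongr
            exact div_le_one_of_le₀ h3 (by positivity)
        _ = _ := by ring
    rw [Finset.sum_range_succ, ← hP, qFactor_succ]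
    calc (P + t ^ (n + 2) * hookSum t (n + 2)) * ((1 - t) * (qFactor t n * (1 - t ^ (n + 1))))
        ≤ (P + t ^ (n + 1) * P) * ((1 - t) * (qFactor t n * (1 - t ^ (n + 1)))) := by gcongr
      _ = P * ((1 - t) * qFactor t n) * (1 - (t ^ (n + 1)) ^ 2) := by ring
      _ ≤ 1 * 1 := by
          refine mul_le_mul ih (sub_le_self _ (by positivity)) ?_ zero_le_one
          nlinarith
      _ = 1 := one_mul 1

theorem pow_mul_pow_le_cube_one_sub_sub_sq {t : ℝ} (h0 : 0 < t) (ht : t ≤ 1 / 2) :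
    (1 - t) ^ 5 * (1 - t ^ 2) ^ 4 ≤ (1 - t - t ^ 2) ^ 3 := by
  -- This maps `0 < t ≤ 1/2` to `x ≥ 0`, where the numerator of the difference has only positive
  -- coefficients.
  obtain ⟨x, hx, rfl⟩ : ∃ x : ℝ, 0 ≤ x ∧ t = 1 / (2 + x) := by
    refine ⟨1 / t - 2, ?_, by field_simp; ring⟩
    rw [sub_nonneg, le_div_iff₀ h0]
    linarith
  have h2 : 0 < 2 + x := by positivity
  rw [← sub_nonneg]
  have h : (1 - 1 / (2 + x) - (1 / (2 + x)) ^ 2) ^ 3 -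
      (1 - 1 / (2 + x)) ^ 5 * (1 - (1 / (2 + x)) ^ 2) ^ 4 =
      (47 + 763 * x + 4602 * x ^ 2 + 14618 * x ^ 3 + 28149 * x ^ 4 + 35445 * x ^ 5 +
        30430 * x ^ 6 + 18155 * x ^ 7 + 7530 * x ^ 8 + 2129 * x ^ 9 + 391 * x ^ 10 +
        42 * x ^ 11 + 2 * x ^ 12) / (2 + x) ^ 13 := by
    field_simp
    ring
  rw [h]
  positivity

/-- The recursion and `(t;t)_n ≥ 1 - t - t²` give `t^n / ((1-t)(1-t-t²)³)`. The denominator is then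
weakened to a form whose quotient by the two-row denominator `(1-t)²(1-t²)^4` is exactly `(1-t)^4`.
-/
theorem hookSum_le_of_le_half {t : ℝ} (h0 : 0 < t) (ht : t ≤ 1 / 2) (n : ℕ) :
    hookSum t n ≤ t ^ n / ((1 - t) ^ 6 * (1 - t ^ 2) ^ 4) := by
  have h1 : t < 1 := by linarith
  have hu : 0 < 1 - t := sub_pos.2 h1
  have hu2 : 0 < 1 - t ^ 2 := one_sub_pow_pos h0 h1 two_ne_zero
  have hd : 0 < 1 - t - t ^ 2 := by nlinarith
  rcases n.eq_zero_or_pos with rfl | hn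
  · rw [hookSum_zero, pow_zero]
    refine one_le_one_div (by positivity) (mul_le_one₀ ?_ (by positivity) ?_)
    · exact pow_le_one₀ hu.le (by linarith)
    · exact pow_le_one₀ hu2.le (one_sub_pow_le_one h0 2)
  have hP : ∑ m ∈ Finset.range n, t ^ m * hookSum t m ≤ 1 / ((1 - t) * (1 - t - t ^ 2)) := by
    have hle : ∑ m ∈ Finset.range n, t ^ m * hookSum t m ≤
        ∑ m ∈ Finset.range (n + 2), t ^ m * hookSum t m :=
      Finset.sum_le_sum_of_subset_of_nonneg (Finset.range_subset_range.2 (by omega))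
        fun m _ _ => mul_nonneg (pow_pos h0 m).le (hookSum_nonneg h0 h1 m)
    have hq := qFactor_pos h0 h1 n
    calc _ ≤ _ := hle
      _ ≤ 1 / ((1 - t) * qFactor t n) := by
          rw [le_div_iff₀ (by positivity)]
          exact sum_pow_mul_hookSum_mul_le h0 ht n
      _ ≤ _ := by
          gcongr
          exact le_qFactor h0 h1 n
  calc hookSum t n ≤ t ^ n / qFactor t n ^ 2 * ∑ m ∈ Finset.range n, t ^ m * hookSum t m :=
        hookSum_le h0 h1 hn
    _ ≤ t ^ n / (1 - t - t ^ 2) ^ 2 * (1 / ((1 - t) * (1 - t - t ^ 2))) := by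
        have := le_qFactor h0 h1 n
        have hP0 : 0 ≤ ∑ m ∈ Finset.range n, t ^ m * hookSum t m := Finset.sum_nonneg
          fun m _ => mul_nonneg (pow_pos h0 m).le (hookSum_nonneg h0 h1 m)
        gcongr
    _ = t ^ n / ((1 - t) * (1 - t - t ^ 2) ^ 3) := by
        rw [div_mul_div_comm]
        congr 1 <;> ring
    _ ≤ t ^ n / ((1 - t) * ((1 - t) ^ 5 * (1 - t ^ 2) ^ 4)) := by
        gcongr
        exact pow_mul_pow_le_cube_one_sub_sub_sq h0 ht
    _ = _ := by
        congr 1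
        ring

end YoungDiagram

/-! ### Cancelling the infinite product -/

open YoungDiagram

theorem summable_log_one_sub_pow {t : ℝ} (h0 : 0 < t) (ht : t ≤ 1 / 2) :
    Summable fun p : ℕ × ℕ => Real.log (1 - t ^ (p.1 + 1 + p.2)) := by
  have h1 : t < 1 := by linarith
  have hg : Summable fun n : ℕ => t ^ n := summable_geometric_of_lt_one h0.le h1
  have hs : Summable fun p : ℕ × ℕ => 2 * (t ^ p.1 * t ^ p.2) :=
    (hg.mul_of_nonneg hg (fun n => (pow_pos h0 n).le) fun n => (pow_pos h0 n).le).mul_left 2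
  refine Summable.of_norm_bounded hs ?_
  rintro ⟨i, j⟩
  have hx0 : 0 < t ^ (i + 1 + j) := pow_pos h0 _
  have hx : t ^ (i + 1 + j) ≤ 1 / 2 :=
    (pow_le_of_le_one h0.le h1.le (by omega)).trans ht
  have hxle : t ^ (i + 1 + j) ≤ t ^ i * t ^ j := by
    rw [← pow_add]
    exact pow_le_pow_of_le_one h0.le h1.le (by omega)
  have hpos : 0 < 1 - t ^ (i + 1 + j) := by linarith
  have hlog := Real.one_sub_inv_le_log_of_pos hpos
  have hneg := Real.log_nonpos hpos.le (by linarith)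
  have hinv : (1 - t ^ (i + 1 + j))⁻¹ ≤ 1 + 2 * t ^ (i + 1 + j) := by
    rw [inv_le_iff_one_le_mul₀ hpos]
    nlinarith
  rw [Real.norm_eq_abs, abs_of_nonpos hneg]
  dsimp only
  linarith

/-- Summable logarithms turn the iterated product into an exponential. Being nonzero is what lets
the constant cancel in the quotient. -/
theorem tprod_tprod_one_sub_pow_pos {t : ℝ} (h0 : 0 < t) (ht : t ≤ 1 / 2) :
    0 < ∏' i : ℕ, ∏' j : ℕ, (1 - t ^ (i + 1 + j)) := by
  have hs := summable_log_one_sub_pow h0 ht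
  have hin : ∀ i : ℕ, ∏' j : ℕ, (1 - t ^ (i + 1 + j)) =
      Real.exp (∑' j : ℕ, Real.log (1 - t ^ (i + 1 + j))) := fun i =>
    (Real.rexp_tsum_eq_tprod (fun j => one_sub_pow_pos h0 (by linarith) (by omega))
      (hs.prod_factor i)).symm
  simp only [hin]
  rw [← Real.rexp_tsum_eq_tprod (fun i => Real.exp_pos _)]
  · exact Real.exp_pos _
  · simpa only [Real.log_exp] using hs.prod

theorem exists_tildeQ_eq {q : ℝ} (hq : 2 ≤ q) :
    ∃ c : ℝ, 0 < c ∧ ∀ lam : YoungDiagram, tildeQ q lam = c * hookWeight (1 / q) lam := by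
  have h0 : 0 < 1 / q := by positivity
  have ht : 1 / q ≤ 1 / 2 := one_div_le_one_div_of_le two_pos hq
  refine ⟨_, tprod_tprod_one_sub_pow_pos h0 ht, fun lam => ?_⟩
  rw [tildeQ, hookWeight]
  simp only [one_div, inv_pow, Finset.prod_inv_distrib, mul_inv]
  rw [div_eq_mul_inv]

theorem firstRowProbQ_eq {q : ℝ} (hq : 2 ≤ q) (n r : ℕ) :
    firstRowProbQ n r q =
      (∑ lam ∈ ofSize n with lam.rowLen 0 < r, hookWeight (1 / q) lam) / hookSum (1 / q) n := by
  obtain ⟨c, hc, h⟩ := exists_tildeQ_eq hq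
  rw [firstRowProbQ, Finset.sum_div]
  refine Finset.sum_congr rfl fun lam hl => ?_
  rw [measQ, if_pos (mem_ofSize.1 (Finset.mem_filter.1 hl).1)]
  simp only [h, hookSum]
  rw [← Finset.mul_sum, mul_div_mul_left _ _ hc.ne']

theorem hookSum_pos {t : ℝ} (h0 : 0 < t) (h1 : t < 1) (n : ℕ) : 0 < hookSum t n :=
  (div_pos (pow_pos h0 n) (pow_pos (qFactor_pos h0 h1 n) 2)).trans_le (le_hookSum h0 h1 n)

theorem firstRowProbQ_nonneg {q : ℝ} (hq : 2 ≤ q) (n r : ℕ) : 0 ≤ firstRowProbQ n r q := by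
  have h0 : 0 < 1 / q := by positivity
  have h1 : 1 / q < 1 := by
    rw [div_lt_one (by positivity)]
    linarith
  rw [firstRowProbQ_eq hq]
  exact div_nonneg (Finset.sum_nonneg fun lam _ => (hookWeight_pos h0 h1 lam).le)
    (hookSum_pos h0 h1 n).le

/-! ### Upper and lower bounds for the probability -/

/-- The prefactor `t^n/(t;t)_n²` is the weight of the one-row partition, hence at most the
normalizing sum. -/
theorem firstRowProbQ_le_sum {q : ℝ} (hq : 2 ≤ q) {n : ℕ} (hn : 0 < n) (r : ℕ) :
    firstRowProbQ n r q ≤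
      ∑ m ∈ Finset.Ico (n + 1 - r) n, (1 / q) ^ m * hookSum (1 / q) m := by
  have h0 : 0 < 1 / q := by positivity
  have h1 : 1 / q < 1 := by
    rw [div_lt_one (by positivity)]
    linarith
  rw [firstRowProbQ_eq hq, div_le_iff₀ (hookSum_pos h0 h1 n), mul_comm]
  refine (sum_hookWeight_filter_le h0 h1 hn).trans ?_
  refine mul_le_mul_of_nonneg_right (le_hookSum h0 h1 n) (Finset.sum_nonneg fun m _ => ?_)
  exact mul_nonneg (pow_pos h0 m).le (hookSum_nonneg h0 h1 m)

theorem sum_Ico_pow_mul_hookSum_le {t : ℝ} (h0 : 0 < t) (ht : t ≤ 1 / 2) (k n : ℕ) :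
    ∑ m ∈ Finset.Ico k n, t ^ m * hookSum t m ≤ t ^ (2 * k) / (1 - t) ^ 9 := by
  have h1 : t < 1 := by linarith
  have hu : 0 < 1 - t := sub_pos.2 h1
  have hu2 : 0 < 1 - t ^ 2 := one_sub_pow_pos h0 h1 two_ne_zero
  have hkey : 1 - t ≤ (1 - t ^ 2) ^ 2 := by nlinarith [mul_nonneg h0.le (sq_nonneg t)]
  have hkey' : (1 - t) ^ 3 ≤ (1 - t ^ 2) ^ 5 := by
    calc (1 - t) ^ 3 ≤ ((1 - t ^ 2) ^ 2) ^ 3 := by gcongr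
      _ = (1 - t ^ 2) ^ 6 := by ring
      _ ≤ _ := pow_le_pow_of_le_one hu2.le (one_sub_pow_le_one h0 2) (by norm_num)
  calc ∑ m ∈ Finset.Ico k n, t ^ m * hookSum t m
      ≤ ∑ m ∈ Finset.Ico k n, (t ^ 2) ^ m * (1 / ((1 - t) ^ 6 * (1 - t ^ 2) ^ 4)) := by
        refine Finset.sum_le_sum fun m _ => ?_
        calc t ^ m * hookSum t m ≤ t ^ m * (t ^ m / ((1 - t) ^ 6 * (1 - t ^ 2) ^ 4)) := by
              gcongr
              exact hookSum_le_of_le_half h0 ht m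
          _ = _ := by ring
    _ ≤ (t ^ 2) ^ k / (1 - t ^ 2) * (1 / ((1 - t) ^ 6 * (1 - t ^ 2) ^ 4)) := by
        rw [← Finset.sum_mul]
        gcongr
        exact geom_sum_Ico_le_of_lt_one (by positivity) (by linarith)
    _ = t ^ (2 * k) / ((1 - t) ^ 6 * (1 - t ^ 2) ^ 5) := by
        rw [div_mul_div_comm, ← pow_mul]
        congr 1 <;> ring
    _ ≤ t ^ (2 * k) / ((1 - t) ^ 6 * (1 - t) ^ 3) := by gcongr
    _ = _ := by ring

theorem le_firstRowProbQ {q : ℝ} (hq : 2 ≤ q) {n r k : ℕ} (hk : 2 ≤ k) (hn : n + 1 = r + k)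
    (hkr : k < r) : (1 - 1 / q) ^ 4 * (1 / q) ^ (2 * k) ≤ firstRowProbQ n r q := by
  have h0 : 0 < 1 / q := by positivity
  have ht : 1 / q ≤ 1 / 2 := one_div_le_one_div_of_le two_pos hq
  rw [firstRowProbQ_eq hq]
  generalize 1 / q = t at h0 ht
  have h1 : t < 1 := by linarith
  have hu : 0 < 1 - t := sub_pos.2 h1
  have hu2 : 0 < 1 - t ^ 2 := one_sub_pow_pos h0 h1 two_ne_zero
  obtain ⟨a, rfl⟩ : ∃ a, r = a + 1 := ⟨r - 1, by omega⟩
  obtain rfl : n = a + k := by omega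
  have hb : (⊥ : YoungDiagram).rowLen 0 ≤ k := (rowLen_le_card _ _).trans (Nat.zero_le k)
  have hc : (⊥ : YoungDiagram).card = 0 := rfl
  have hr : (consRow k ⊥).rowLen 0 ≤ a := by
    rw [rowLen_consRow]
    omega
  have hmem : consRow a (consRow k ⊥) ∈
      (ofSize (a + k)).filter fun lam => lam.rowLen 0 < a + 1 := by
    rw [Finset.mem_filter, mem_ofSize, card_consRow _ _ hr, card_consRow _ _ hb, hc,
      rowLen_consRow]
    omega
  rw [le_div_iff₀ (hookSum_pos h0 h1 _)]
  calc (1 - t) ^ 4 * t ^ (2 * k) * hookSum t (a + k)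
      ≤ (1 - t) ^ 4 * t ^ (2 * k) * (t ^ (a + k) / ((1 - t) ^ 6 * (1 - t ^ 2) ^ 4)) := by
        gcongr
        exact hookSum_le_of_le_half h0 ht _
    _ = t ^ (a + k) * t ^ (2 * k) / ((1 - t) ^ 2 * (1 - t ^ 2) ^ 4) := by
        field_simp
    _ ≤ hookWeight t (consRow a (consRow k ⊥)) := le_hookWeight_two_rows h0 h1 hk (by omega)
    _ ≤ _ := Finset.single_le_sum (f := hookWeight t)
        (fun mu _ => (hookWeight_pos h0 h1 mu).le) hmem

theorem firstRowProbQ_upper {n r : ℕ} {q : ℝ} (hq : 2 ≤ q) (hr : r < n) :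
    firstRowProbQ n r q ≤
      1 / (1 - 1 / q) ^ (1 + 4 * Real.sqrt (2 * (n : ℝ))) * (1 / q) ^ (2 * (n + 1 - r)) := by
  have h0 : 0 < 1 / q := by positivity
  have ht : 1 / q ≤ 1 / 2 := one_div_le_one_div_of_le two_pos hq
  have hu : 0 < 1 - 1 / q := by linarith
  have h := firstRowProbQ_le_sum hq (by omega : 0 < n) r
  -- For `r < 2` no tail size is admissible; otherwise `n ≥ 3`, so `√(2n) ≥ 2` and the exponent is
  -- at least 9.
  rcases Nat.lt_or_ge r 2 with h2 | h2
  · rw [Finset.Ico_eq_empty (by omega), Finset.sum_empty] at h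
    exact h.trans (by positivity)
  · refine h.trans ((sum_Ico_pow_mul_hookSum_le h0 ht _ _).trans ?_)
    have hn : (3 : ℝ) ≤ n := by exact_mod_cast (by omega : 3 ≤ n)
    have hs : 2 ≤ Real.sqrt (2 * (n : ℝ)) := Real.le_sqrt_of_sq_le (by linarith)
    have hpow : (1 - 1 / q) ^ (1 + 4 * Real.sqrt (2 * (n : ℝ))) ≤ (1 - 1 / q) ^ 9 := by
      rw [← Real.rpow_natCast (1 - 1 / q) 9]
      refine Real.rpow_le_rpow_of_exponent_ge hu (by linarith) ?_
      push_cast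
      linarith
    rw [div_mul_eq_mul_div, one_mul]
    gcongr

theorem mainTheorem1 (n r : ℕ) (q : ℝ) (hq : 2 ≤ q) (hr : (r : ℤ) ≤ (n : ℤ) - 1) :
    firstRowProbQ n r q ≤
        1 / (1 - 1 / q) ^ (1 + 4 * Real.sqrt (2 * (n : ℝ))) *
          (1 / q ^ (2 * (n : ℤ) - 2 * (r : ℤ) + 2) +
            1 / (1 - 1 / q ^ (2 * n + 1)) * (1 / q ^ (n + 1))) ∧
      (1 - 1 / q ^ n) * (1 - 1 / q) ^ 4 *
          (1 / q ^ (2 * (n : ℤ) - 2 * (r : ℤ) + 2) -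
            1 / (q ^ (n + 1) * (1 - 1 / q)) -
            1 / (q ^ (2 * (n : ℤ) - 2 * (r : ℤ) + 3) * (1 - 1 / q) ^ 2) -
            1 / (q ^ (3 * (n : ℤ) - 3 * (r : ℤ) + 4) * (1 - 1 / q) ^ 3) -
            1 / (1 - 1 / q) ^ 2 * (1 / (q ^ (2 * n + 3) * (1 - 1 / q ^ (2 * n + 3))))) ≤
        firstRowProbQ n r q := by
  have hq0 : 0 < q := by linarith
  have hq1 : 1 < q := by linarith
  have h0 : 0 < 1 / q := by positivity
  have ht : 1 / q ≤ 1 / 2 := one_div_le_one_div_of_le two_pos hq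
  have hu : 0 < 1 - 1 / q := by linarith
  have hpow : ∀ m : ℕ, m ≠ 0 → 0 < 1 - 1 / q ^ m := fun m hm => by
    rw [← one_div_pow]
    exact one_sub_pow_pos h0 (by linarith) hm
  have hrn : r < n := by omega
  obtain ⟨k, hk⟩ : ∃ k, n + 1 = r + k := ⟨n + 1 - r, by omega⟩
  have hmain : 1 / q ^ (2 * (n : ℤ) - 2 * (r : ℤ) + 2) = (1 / q) ^ (2 * k) := by
    rw [show 2 * (n : ℤ) - 2 * (r : ℤ) + 2 = ((2 * k : ℕ) : ℤ) by push_cast; omega,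
      zpow_natCast, one_div_pow]
  rw [hmain]
  constructor
  · have h := firstRowProbQ_upper hq hrn
    rw [show n + 1 - r = k by omega] at h
    have hx := hpow (2 * n + 1) (by omega)
    refine h.trans (mul_le_mul_of_nonneg_left ?_ (by positivity))
    exact le_add_of_nonneg_right (by positivity)
  · have hx := hpow n (by omega)
    have hy := hpow (2 * n + 3) (by omega)
    set A := 1 / (q ^ (n + 1) * (1 - 1 / q)) with hA
    set B := 1 / (q ^ (2 * (n : ℤ) - 2 * (r : ℤ) + 3) * (1 - 1 / q) ^ 2) with hB
    set C := 1 / (q ^ (3 * (n : ℤ) - 3 * (r : ℤ) + 4) * (1 - 1 / q) ^ 3) with hC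
    set D := 1 / (1 - 1 / q) ^ 2 * (1 / (q ^ (2 * n + 3) * (1 - 1 / q ^ (2 * n + 3)))) with hD
    have hB0 : 0 ≤ B := by positivity
    have hC0 : 0 ≤ C := by positivity
    have hD0 : 0 ≤ D := by positivity
    -- `k < r` is exactly the condition for `(r-1, k)` to be a partition.
    rcases lt_or_ge k r with hkr | hkr
    · have hA0 : 0 ≤ A := by positivity
      calc (1 - 1 / q ^ n) * (1 - 1 / q) ^ 4 * ((1 / q) ^ (2 * k) - A - B - C - D)
          ≤ (1 - 1 / q ^ n) * (1 - 1 / q) ^ 4 * (1 / q) ^ (2 * k) := by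
            gcongr
            linarith
        _ ≤ 1 * (1 - 1 / q) ^ 4 * (1 / q) ^ (2 * k) := by
            gcongr
            exact sub_le_self _ (by positivity)
        _ = (1 - 1 / q) ^ 4 * (1 / q) ^ (2 * k) := by ring
        _ ≤ _ := le_firstRowProbQ hq (by omega) hk hkr
    · refine le_trans ?_ (firstRowProbQ_nonneg hq n r)
      have hA1 : (1 / q) ^ (2 * k) ≤ A := by
        calc (1 / q) ^ (2 * k) ≤ (1 / q) ^ (n + 1) :=
              pow_le_pow_of_le_one h0.le (by linarith) (by omega)
          _ = 1 / (q ^ (n + 1) * 1) := by rw [one_div_pow, mul_one]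
          _ ≤ A := by
              rw [hA]
              gcongr
              linarith
      exact mul_nonpos_of_nonneg_of_nonpos (by positivity) (by linarith)
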